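/- **Theorem (Clipped Triple Q-learning).** Let $S$ and $A$ be finite nonempty sets of states and actions, and consider a Markov decision process on them: when action $a$ is taken in state $s$, the pair (next state, reward) is drawn from a probability law $p(\cdot\mid s,a)$ on $S\times\mathbb R$. Assume that the reward $r(s,a)$ has finite variance for every $(s,a)$, and let $\gamma\in[0,1)$. Let $(s_t,a_t,r_t)_{t\ge 0}$ be a trajectory of the process, adapted to a filtration $(P_t)_{t\ge0}$ such that $s_t,a_t$ are $P_t$-measurable, $r_t$ is $P_{t+1}$-measurable, and the conditional law of $(s_{t+1},r_t)$ given $P_t$ is $p(\cdot\mid s_t,a_t)$. Assume that with probability $1$ every state-action pair is visited infinitely often. Let the learning rates $\alpha_t(s,a)$ be $P_t$-measurable random variables such that, with probability $1$, for all $(s,a)$: $\alpha_t(s,a)\in[0,1]$ and $\alpha_t(s,a)=0$ whenever $(s,a)\ne(s_t,a_t)$, for every $t$; $\sum_t\alpha_t(s,a)=\infty$; and $\sum_t\alpha_t(s,a)^2<\infty$. Call a Borel map $g:\mathbb R^3\to\mathbb R$ a *target map* if for every $\varepsilon>0$ there is $\delta>0$ such that $|g(x,y,z)-x|\le\varepsilon$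 for all real $x,y,z$ with $|y-x|\le\delta$ and $|z-x|\le\delta$. Given a target map $g$, start from three tables $Q^A_0,Q^B_0,Q^C_0:S\times A\to\mathbb R$ that may be random but are $P_0$-measurable, and at each time $t$ update all three tables toward one shared target: let $a^*_t$ be a maximizer of $Q^A_t(s_{t+1},\cdot)$ (ties broken in any $P_{t+1}$-measurable way), put $$y_t=r_t+\gamma\, g\bigl(Q^A_t(s_{t+1},a^*_t),\,Q^B_t(s_{t+1},a^*_t),\,Q^C_t(s_{t+1},a^*_t)\bigr),$$ and for $i\in\{A,B,C\}$ and all $(s,a)$ set $$Q^i_{t+1}(s,a)=Q^i_t(s,a)+\alpha_t(s,a)\bigl(y_t-Q^i_t(s,a)\bigr).$$ Then the Bellman optimality equation $$Q(s,a)=\mathbb E[r(s,a)]+\gamma\sum_{s'\in S}p(s'\mid s,a)\max_{a'\in A}Q(s',a')\qquad\text{for all }(s,a)$$ has exactly one solution $Q^*:S\times A\to\mathbb R$ (the optimal action-value function), and with probability $1$ $$Q^A_t(s,a)\to Q^*(s,a),\qquad Q^B_t(s,a)\to Q^*(s,a),\qquad Q^C_t(s,a)\to Q^*(s,a)$$ as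 $t\to\infty$, for every $(s,a)\in S\times A$. Moreover, the mean of the smaller two of three numbers and the median of three numbers are target maps, so the result applies to both. -/

import Mathlib

open MeasureTheory ProbabilityTheory Filter Topology

/-- A Markov decision process with state space `S`, action space `A` and real random rewards:
`step s a` is the joint law of (next state, reward) when action `a` is taken in state `s`. -/
structure MDP (S A : Type*) [MeasurableSpace S] where
  step : S → A → Measure (S × ℝ)
  isProbabilityMeasure_step : ∀ s a, IsProbabilityMeasure (step s a)

namespace MDP

variable {S A : Type*} [MeasurableSpace S]

/-- The probability of moving to `s'` when action `a` is taken in state `s`. -/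
noncomputable def transProb (M : MDP S A) (s : S) (a : A) (s' : S) : ℝ :=
  (M.step s a).real {x | x.1 = s'}

/-- The expected reward of the pair `(s, a)`. -/
noncomputable def meanReward (M : MDP S A) (s : S) (a : A) : ℝ :=
  ∫ x, x.2 ∂(M.step s a)

/-- Every reward `r(s, a)` has finite variance. -/
def FiniteRewardVariance (M : MDP S A) : Prop :=
  ∀ s a, evariance (fun x : S × ℝ => x.2) (M.step s a) < ⊤

/-- The Bellman optimality equation for `Q`, with discount factor `γ` (`S` and `A` finite, so that
the supremum over the actions is a maximum). -/
def BellmanOptimality [Fintype S] (M : MDP S A) (γ : ℝ) (Q : S → A → ℝ) : Prop :=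
  ∀ s a, Q s a = M.meanReward s a + γ * ∑ s', M.transProb s a s' * ⨆ a', Q s' a'

end MDP

/-- The mean of the smaller two of three numbers. -/
noncomputable def meanSmallerTwo (x y z : ℝ) : ℝ :=
  (x + y + z - max (max x y) z) / 2

/-- The median of three numbers. -/
noncomputable def medianThree (x y z : ℝ) : ℝ :=
  max (min x y) (min (max x y) z)

/-- The maps that combine three estimates into one target value: Borel maps such that
`g x y z - x` tends to `0` when `y - x` and `z - x` tend to `0`, uniformly in `x`. -/
structure IsTargetMap (g : ℝ → ℝ → ℝ → ℝ) : Prop where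
  measurable : Measurable (fun p : ℝ × ℝ × ℝ => g p.1 p.2.1 p.2.2)
  near_diagonal : ∀ ε > 0, ∃ δ > 0, ∀ x y z : ℝ,
    |y - x| ≤ δ → |z - x| ≤ δ → |g x y z - x| ≤ ε

/-- `s`, `a`, `r` is a trajectory of the decision process `M`: in state `s t` the action `a t` is
taken, and then the reward `r t` and the next state `s (t + 1)` are observed. The σ-algebra `ℱ t`
is the information available when `a t` has been chosen. The actions may depend in any
way on the past. -/
structure IsTrajectory {S A Ω : Type*} [MeasurableSpace S] [MeasurableSpace A]
    {mΩ : MeasurableSpace Ω} (M : MDP S A) (μ : Measure Ω) (ℱ : Filtration ℕ mΩ)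
    (s : ℕ → Ω → S) (a : ℕ → Ω → A) (r : ℕ → Ω → ℝ) : Prop where
  measurable_state : ∀ t, Measurable[ℱ t] (s t)
  measurable_action : ∀ t, Measurable[ℱ t] (a t)
  measurable_reward : ∀ t, Measurable[ℱ (t + 1)] (r t)
  /-- Given the past, the pair (next state, reward) has law `M.step (s t) (a t)`. -/
  markov : ∀ t, ∀ B : Set (S × ℝ), MeasurableSet B →
    μ[Set.indicator {ω | (s (t + 1) ω, r t ω) ∈ B} (fun _ => (1 : ℝ)) | ℱ t]
      =ᵐ[μ] fun ω => (M.step (s t ω) (a t ω)).real B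

/-- Learning rates `α t ω x y` for the pair (state `x`, action `y`) at time `t`: known at time `t`
and, with probability one, in `[0, 1]`, zero off the visited pair `(s t, a t)`, and of divergent
sum and convergent sum of squares for each pair. -/
structure IsLearningRate {S A Ω : Type*} {mΩ : MeasurableSpace Ω}
    (μ : Measure Ω) (ℱ : Filtration ℕ mΩ) (s : ℕ → Ω → S) (a : ℕ → Ω → A)
    (α : ℕ → Ω → S → A → ℝ) : Prop where
  measurable : ∀ t x y, Measurable[ℱ t] (fun ω => α t ω x y)
  mem_Icc : ∀ᵐ ω ∂μ, ∀ t x y, α t ω x y ∈ Set.Icc (0 : ℝ) 1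
  eq_zero : ∀ᵐ ω ∂μ, ∀ t x y, (x, y) ≠ (s t ω, a t ω) → α t ω x y = 0
  sum_eq_top : ∀ᵐ ω ∂μ, ∀ x y,
    Tendsto (fun n => ∑ t ∈ Finset.range n, α t ω x y) atTop atTop
  summable_sq : ∀ᵐ ω ∂μ, ∀ x y, Summable (fun t => (α t ω x y) ^ 2)

/-- The shared target `r + γ g(Q^A(s', a*), Q^B(s', a*), Q^C(s', a*))`. -/
def sharedTarget {S A : Type*} (γ : ℝ) (g : ℝ → ℝ → ℝ → ℝ) (QA QB QC : S → A → ℝ)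
    (reward : ℝ) (s' : S) (aStar : A) : ℝ :=
  reward + γ * g (QA s' aStar) (QB s' aStar) (QC s' aStar)

/-- `QA`, `QB`, `QC` are the three tables produced by clipped triple Q-learning with target map `g`
along the trajectory `s`, `a`, `r`. The action `aStar t` maximizes `QA t` in state `s (t + 1)`, ties
being broken in any way, and all three tables are moved toward the same target. (Where the learning
rate is zero, the entry does not change.) -/
structure IsClippedTripleQ {S A Ω : Type*} [MeasurableSpace A]
    {mΩ : MeasurableSpace Ω} (ℱ : Filtration ℕ mΩ) (γ : ℝ) (g : ℝ → ℝ → ℝ → ℝ)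
    (s : ℕ → Ω → S) (r : ℕ → Ω → ℝ) (aStar : ℕ → Ω → A) (α : ℕ → Ω → S → A → ℝ)
    (QA QB QC : ℕ → Ω → S → A → ℝ) : Prop where
  measurable_initA : ∀ x y, Measurable[ℱ 0] (fun ω => QA 0 ω x y)
  measurable_initB : ∀ x y, Measurable[ℱ 0] (fun ω => QB 0 ω x y)
  measurable_initC : ∀ x y, Measurable[ℱ 0] (fun ω => QC 0 ω x y)
  measurable_argmax : ∀ t, Measurable[ℱ (t + 1)] (aStar t)
  argmax : ∀ t ω y, QA t ω (s (t + 1) ω) y ≤ QA t ω (s (t + 1) ω) (aStar t ω)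
  updateA : ∀ t ω x y, QA (t + 1) ω x y = QA t ω x y + α t ω x y *
    (sharedTarget γ g (QA t ω) (QB t ω) (QC t ω) (r t ω) (s (t + 1) ω) (aStar t ω) - QA t ω x y)
  updateB : ∀ t ω x y, QB (t + 1) ω x y = QB t ω x y + α t ω x y *
    (sharedTarget γ g (QA t ω) (QB t ω) (QC t ω) (r t ω) (s (t + 1) ω) (aStar t ω) - QB t ω x y)
  updateC : ∀ t ω x y, QC (t + 1) ω x y = QC t ω x y + α t ω x y *
    (sharedTarget γ g (QA t ω) (QB t ω) (QC t ω) (r t ω) (s (t + 1) ω) (aStar t ω) - QC t ω x y)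

/-! The three tables share target and step size, so the target cancels in a difference of two
tables: it is multiplied by `1 - α t` at each step and tends to `0` on almost every path, whatever
the rewards do. By the near-diagonal property of `g`, the value of `g` in the target then differs
from the maximum of `QA t` at the next state by an error `e t → 0`. Thus `QA` is ordinary Q-learning
with a vanishing bias, and `QB`, `QC` follow it.

For `D = QA - Qstar` the update averages `D` with an input of size at most `γ * ‖D‖ + γ * |e|` (the
Bellman operator is a `γ`-contraction in sup norm) and adds martingale noise. The difficulty is that
the noise grows with the tables, which are not known to be bounded. It is therefore divided by the
running maximum `G` of `‖D‖` and `1`, known at time `t`. The normalized noise is a finite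
combination of fixed square-integrable functions of (next state, reward), centered, with
past-measurable, square-summable weights; its series converges almost surely by the L² martingale
argument in `ae_exists_tendsto_of_summable_sq_weights`.

The rest is pathwise (`tendsto_async_recursion`). Once the tails of the noise series are below `η`,
the noise contributes at most `2 * η * G`. A small `η` and `γ < 1` make `G` bounded; the limsup `L`
of `‖D‖` then satisfies `L ≤ γ * L`, so it is `0`. -/

theorem isTargetMap_meanSmallerTwo : IsTargetMap meanSmallerTwo where
  measurable := by unfold meanSmallerTwo; fun_prop
  near_diagonal ε hε := by
    refine ⟨ε, hε, fun x y z hy hz => ?_⟩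
    unfold meanSmallerTwo
    rw [abs_le] at *
    rcases max_cases (max x y) z with h | h <;> rcases max_cases x y with h' | h' <;>
      constructor <;> linarith

theorem isTargetMap_medianThree : IsTargetMap medianThree where
  measurable := by unfold medianThree; fun_prop
  near_diagonal ε hε := by
    refine ⟨ε, hε, fun x y z hy hz => ?_⟩
    unfold medianThree
    rw [abs_le] at *
    have h₁ : x - ε ≤ min x y := le_min (by linarith) (by linarith)
    have h₂ : max x y ≤ x + ε := max_le (by linarith) (by linarith)
    have h₃ : max (min x y) (min (max x y) z) ≤ max x y :=
      max_le (min_le_max) (min_le_left _ _)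
    have h₄ := le_max_left (min x y) (min (max x y) z)
    constructor <;> linarith

/-! ### Deterministic stochastic-approximation recursions -/

/-- The inequality `1 - x ≤ exp (-x)` bounds the product by the exponential of minus the divergent
sum. -/
theorem tendsto_prod_one_sub_zero {α : ℕ → ℝ} (hα : ∀ t, α t ∈ Set.Icc (0 : ℝ) 1)
    (hsum : Tendsto (fun n => ∑ t ∈ Finset.range n, α t) atTop atTop) :
    Tendsto (fun n => ∏ t ∈ Finset.range n, (1 - α t)) atTop (𝓝 0) := by
  refine squeeze_zero (fun n => Finset.prod_nonneg fun t _ => by linarith [(hα t).2])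
    (fun n => ?_) (Real.tendsto_exp_neg_atTop_nhds_zero.comp hsum)
  simp only [Function.comp_apply, ← Finset.sum_neg_distrib, Real.exp_sum]
  exact Finset.prod_le_prod (fun t _ => by linarith [(hα t).2])
    (fun t _ => Real.one_sub_le_exp_neg _)

theorem tendsto_sum_range_add_atTop {α : ℕ → ℝ} (T : ℕ)
    (hsum : Tendsto (fun n => ∑ t ∈ Finset.range n, α t) atTop atTop) :
    Tendsto (fun n => ∑ t ∈ Finset.range n, α (T + t)) atTop atTop := by
  have h := (tendsto_add_atTop_iff_nat T).2 hsum
  refine (tendsto_atTop_add_const_right _ (-∑ t ∈ Finset.range T, α t) h).congr fun n => ?_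
  rw [add_comm n T, Finset.sum_range_add]
  ring

/-- A solution of `u_{t+1} = (1 - α_t) u_t` tends to zero when the steps have divergent sum. -/
theorem tendsto_zero_of_contracting_recursion {α u : ℕ → ℝ}
    (hα : ∀ t, α t ∈ Set.Icc (0 : ℝ) 1)
    (hsum : Tendsto (fun n => ∑ t ∈ Finset.range n, α t) atTop atTop)
    (hu : ∀ t, u (t + 1) = (1 - α t) * u t) : Tendsto u atTop (𝓝 0) := by
  have h : ∀ n, u n = (∏ t ∈ Finset.range n, (1 - α t)) * u 0 := by
    intro n
    induction n with
    | zero => simp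
    | succ n ih => rw [hu, ih, Finset.prod_range_succ]; ring
  have := (tendsto_prod_one_sub_zero hα hsum).mul_const (u 0)
  rw [zero_mul] at this
  exact this.congr fun n => (h n).symm

/-- The response of the averaging recursion to a noise `G t * ξ t`, where `G` is monotone and the
partial sums of `ξ` are bounded by `η`. -/
theorem abs_noise_recursion_le {α G ξ N : ℕ → ℝ} {η : ℝ}
    (hα : ∀ t, α t ∈ Set.Icc (0 : ℝ) 1) (hG : Monotone G) (hG0 : ∀ t, 0 ≤ G t)
    (hξ : ∀ n, |∑ t ∈ Finset.range n, ξ t| ≤ η)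
    (hN0 : N 0 = 0) (hN : ∀ t, N (t + 1) = (1 - α t) * N t + G t * ξ t) (n : ℕ) :
    |N (n + 1)| ≤ 2 * η * G n := by
  set σ : ℕ → ℝ := fun n => ∑ t ∈ Finset.range n, ξ t with hσ
  have hσs : ∀ n, ξ n = σ (n + 1) - σ n := fun n => by simp [hσ, Finset.sum_range_succ]
  -- Summation by parts: this difference obeys a recursion driven by `σ` instead of `ξ`, with
  -- nonnegative coefficients `G (n + 1) - G n`, `α n * G n` and `1 - α n`, so the bound propagates
  -- exactly.
  have hR : ∀ n, |G n * σ n - N n| ≤ η * G n := by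
    intro n
    induction n with
    | zero =>
      have := (abs_nonneg _).trans (hξ 0)
      simpa [hσ, hN0] using mul_nonneg this (hG0 0)
    | succ n ih =>
      have e : G (n + 1) * σ (n + 1) - N (n + 1) = (G (n + 1) - G n) * σ (n + 1)
          + α n * G n * σ n + (1 - α n) * (G n * σ n - N n) := by
        rw [hN, hσs]; ring
      have h1 : |(G (n + 1) - G n) * σ (n + 1)| ≤ (G (n + 1) - G n) * η := by
        have : 0 ≤ G (n + 1) - G n := sub_nonneg.2 (hG n.le_succ)
        rw [abs_mul, abs_of_nonneg this]
        exact mul_le_mul_of_nonneg_left (hξ _) this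
      have h2 : |α n * G n * σ n| ≤ α n * G n * η := by
        have : 0 ≤ α n * G n := mul_nonneg (hα n).1 (hG0 n)
        rw [abs_mul, abs_of_nonneg this]
        exact mul_le_mul_of_nonneg_left (hξ _) this
      have h3 : |(1 - α n) * (G n * σ n - N n)| ≤ (1 - α n) * (η * G n) := by
        have : 0 ≤ 1 - α n := sub_nonneg.2 (hα n).2
        rw [abs_mul, abs_of_nonneg this]
        exact mul_le_mul_of_nonneg_left ih this
      rw [e]
      calc _ ≤ _ := abs_add_three _ _ _
        _ ≤ (G (n + 1) - G n) * η + α n * G n * η + (1 - α n) * (η * G n) := by gcongr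
        _ = η * G (n + 1) := by ring
  -- Using `hR` at `n` rather than `n + 1` gives a bound in `G n`. This matters when `G (n + 1)` is
  -- itself to be bounded.
  have e : N (n + 1) = G n * σ (n + 1) - (α n * G n * σ n + (1 - α n) * (G n * σ n - N n)) := by
    rw [hN, hσs]; ring
  have h1 : |G n * σ (n + 1)| ≤ G n * η := by
    rw [abs_mul, abs_of_nonneg (hG0 n)]
    exact mul_le_mul_of_nonneg_left (hξ _) (hG0 n)
  have h2 : |α n * G n * σ n| ≤ α n * G n * η := by
    have : 0 ≤ α n * G n := mul_nonneg (hα n).1 (hG0 n)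
    rw [abs_mul, abs_of_nonneg this]
    exact mul_le_mul_of_nonneg_left (hξ _) this
  have h3 : |(1 - α n) * (G n * σ n - N n)| ≤ (1 - α n) * (η * G n) := by
    have : 0 ≤ 1 - α n := sub_nonneg.2 (hα n).2
    rw [abs_mul, abs_of_nonneg this]
    exact mul_le_mul_of_nonneg_left (hR n) this
  rw [e]
  calc _ ≤ |G n * σ (n + 1)| + |α n * G n * σ n + (1 - α n) * (G n * σ n - N n)| := abs_sub _ _
    _ ≤ |G n * σ (n + 1)| + (|α n * G n * σ n| + |(1 - α n) * (G n * σ n - N n)|) := by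
      gcongr; exact abs_add_le _ _
    _ ≤ G n * η + (α n * G n * η + (1 - α n) * (η * G n)) := by gcongr
    _ = 2 * η * G n := by ring

/-- The averaging recursion with input bounded by `H` and noise `G t * ξ t`. -/
theorem abs_averaging_recursion_le {α G ξ h u : ℕ → ℝ} {η H : ℝ} {n : ℕ}
    (hα : ∀ t, α t ∈ Set.Icc (0 : ℝ) 1) (hG : Monotone G) (hG0 : ∀ t, 0 ≤ G t)
    (hξ : ∀ n, |∑ t ∈ Finset.range n, ξ t| ≤ η) (hh : ∀ t ≤ n, |h t| ≤ H)
    (hu : ∀ t, u (t + 1) = (1 - α t) * u t + α t * h t + G t * ξ t) :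
    |u (n + 1)| ≤ (∏ t ∈ Finset.range (n + 1), (1 - α t)) * |u 0| + H + 2 * η * G n := by
  -- By linearity, `u` splits into the pure noise response `N` and a noise-free average of the
  -- inputs.
  let N : ℕ → ℝ := fun n => Nat.rec 0 (fun t x => (1 - α t) * x + G t * ξ t) n
  have hN : ∀ t, N (t + 1) = (1 - α t) * N t + G t * ξ t := fun t => rfl
  have hNb := abs_noise_recursion_le hα hG hG0 hξ rfl hN n
  have hH : 0 ≤ H := (abs_nonneg _).trans (hh 0 n.zero_le)
  have key : ∀ m ≤ n + 1,
      |u m - N m| ≤ (∏ t ∈ Finset.range m, (1 - α t)) * |u 0| + H := by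
    intro m hm
    induction m with
    | zero => simp [N, hH]
    | succ m ih =>
      have e : u (m + 1) - N (m + 1) = (1 - α m) * (u m - N m) + α m * h m := by
        rw [hu, hN]; ring
      have h0 : 0 ≤ 1 - α m := sub_nonneg.2 (hα m).2
      rw [e, Finset.prod_range_succ]
      calc _ ≤ |(1 - α m) * (u m - N m)| + |α m * h m| := abs_add_le _ _
        _ = (1 - α m) * |u m - N m| + α m * |h m| := by
          rw [abs_mul, abs_mul, abs_of_nonneg h0, abs_of_nonneg (hα m).1]
        _ ≤ (1 - α m) * ((∏ t ∈ Finset.range m, (1 - α t)) * |u 0| + H) + α m * H := by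
          gcongr
          · exact ih (by omega)
          · exact (hα m).1
          · exact hh m (by omega)
        _ = _ := by ring
  calc |u (n + 1)| = |(u (n + 1) - N (n + 1)) + N (n + 1)| := by ring_nf
    _ ≤ _ := (abs_add_le _ _).trans (add_le_add (key _ le_rfl) hNb)

/-- The running maximum of the norms of a sequence, and of `1`. -/
noncomputable def runningMax {E : Type*} [Norm E] (D : ℕ → E) : ℕ → ℝ
  | 0 => max 1 ‖D 0‖
  | t + 1 => max (runningMax D t) ‖D (t + 1)‖

section runningMax

variable {E : Type*} [SeminormedAddCommGroup E] (D : ℕ → E)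

theorem monotone_runningMax : Monotone (runningMax D) :=
  monotone_nat_of_le_succ fun _ => le_max_left _ _

theorem one_le_runningMax (t : ℕ) : 1 ≤ runningMax D t :=
  (le_max_left _ _).trans (monotone_runningMax D t.zero_le)

theorem norm_le_runningMax (t : ℕ) : ‖D t‖ ≤ runningMax D t := by
  cases t <;> exact le_max_right _ _

end runningMax

/-! ### Asynchronous recursions in several coordinates. -/

section vector

variable {ι : Type*} [Fintype ι] {D α h ξ : ℕ → ι → ℝ} {γ : ℝ} {e : ℕ → ℝ}

/-- The asynchronous recursion started at time `T`, when the noise is small from `T` on. -/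
theorem abs_async_recursion_le {T n : ℕ} {η H : ℝ}
    (hα : ∀ t x, α t x ∈ Set.Icc (0 : ℝ) 1)
    (hD : ∀ t x, D (t + 1) x = (1 - α t x) * D t x + α t x * h t x + runningMax D t * ξ t x)
    (hξ : ∀ x n, |∑ t ∈ Finset.range n, ξ (T + t) x| ≤ η)
    (x : ι) (hh : ∀ t, T ≤ t → t ≤ T + n → |h t x| ≤ H) :
    |D (T + n + 1) x| ≤ (∏ t ∈ Finset.range (n + 1), (1 - α (T + t) x)) * |D T x| + H
      + 2 * η * runningMax D (T + n) :=
  abs_averaging_recursion_le (u := fun t => D (T + t) x) (h := fun t => h (T + t) x)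
    (ξ := fun t => ξ (T + t) x) (G := fun t => runningMax D (T + t)) (α := fun t => α (T + t) x)
    (fun t => hα _ _) (fun i j hij => monotone_runningMax D (by omega))
    (fun t => zero_le_one.trans (one_le_runningMax D _)) (hξ x)
    (fun t ht => hh _ (by omega) (by omega)) (fun t => hD _ _)

theorem exists_noise_small
    (hξ : ∀ x, ∃ l, Tendsto (fun n => ∑ t ∈ Finset.range n, ξ t x) atTop (𝓝 l))
    {η : ℝ} (hη : 0 < η) :
    ∀ᶠ T in atTop, ∀ x n, |∑ t ∈ Finset.range n, ξ (T + t) x| ≤ η := by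
  refine eventually_all.2 fun x => ?_
  obtain ⟨l, hl⟩ := hξ x
  obtain ⟨T₀, hT₀⟩ := Metric.cauchySeq_iff.1 hl.cauchySeq η hη
  filter_upwards [eventually_ge_atTop T₀] with T hT n
  have := (hT₀ (T + n) (by omega) T hT).le
  rwa [Real.dist_eq, Finset.sum_range_add, add_sub_cancel_left] at this

/-- A bound `K` on the running maximum reproduces itself: contraction returns at most `γ * K`, late
noise at most `(1 - γ) / 2 * K`, and the remaining share of `K` absorbs the initial value and the
errors `e`. -/
theorem exists_runningMax_le (hγ : γ ∈ Set.Ico (0 : ℝ) 1)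
    (hα : ∀ t x, α t x ∈ Set.Icc (0 : ℝ) 1)
    (hD : ∀ t x, D (t + 1) x = (1 - α t x) * D t x + α t x * h t x + runningMax D t * ξ t x)
    (hh : ∀ t x, |h t x| ≤ γ * ‖D t‖ + e t) (he : Tendsto e atTop (𝓝 0))
    (hξ : ∀ x, ∃ l, Tendsto (fun n => ∑ t ∈ Finset.range n, ξ t x) atTop (𝓝 l)) :
    ∃ K, ∀ t, runningMax D t ≤ K := by
  obtain ⟨hγ0, hγ1⟩ := hγ
  have hη : 0 < (1 - γ) / 4 := by linarith
  obtain ⟨T, hT⟩ := (exists_noise_small hξ hη).exists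
  obtain ⟨B, hB⟩ := he.bddAbove_range
  replace hB : ∀ t, e t ≤ B := fun t => hB ⟨t, rfl⟩
  set G := runningMax D with hG
  have hT1 := one_le_runningMax D T
  -- `K` solves `K = G T + |B| + γ * K + 2 * η * K` for `η = (1 - γ) / 4`.
  set K := 2 * (G T + |B|) / (1 - γ) with hK
  have hKe : (1 - γ) * K = 2 * (G T + |B|) := by rw [hK]; field_simp [show (1 - γ) ≠ 0 by linarith]
  have hKT : G T ≤ K := by
    rw [hK, le_div_iff₀ (by linarith)]
    nlinarith [abs_nonneg B]
  have key : ∀ n, G (T + n) ≤ K := by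
    intro n
    induction n with
    | zero => exact hKT
    | succ n ih =>
      refine max_le ih ((pi_norm_le_iff_of_nonneg (by linarith)).2 fun x => ?_)
      have := abs_async_recursion_le (n := n) (H := γ * G (T + n) + |B|) hα hD hT x
        (fun t _ h2 => (hh t x).trans (add_le_add (mul_le_mul_of_nonneg_left
          ((norm_le_runningMax D t).trans (monotone_runningMax D h2)) hγ0)
          ((hB t).trans (le_abs_self B))))
      have hp : (∏ t ∈ Finset.range (n + 1), (1 - α (T + t) x)) * |D T x| ≤ G T := by
        refine (mul_le_of_le_one_left (abs_nonneg _) (Finset.prod_le_one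
          (fun t _ => by linarith [(hα (T + t) x).2])
          fun t _ => by linarith [(hα (T + t) x).1])).trans ?_
        exact (norm_le_pi_norm (D T) x).trans (norm_le_runningMax D T)
      rw [Real.norm_eq_abs]
      refine this.trans ?_
      have hm := monotone_runningMax D (show T ≤ T + n by omega)
      nlinarith
  exact ⟨K, fun t => (monotone_runningMax D (by omega : t ≤ T + t)).trans (key t)⟩

/-- Convergence of the asynchronous recursion: the input contracts up to a vanishing error, and
the noise, scaled by the running maximum of the iterates, is summable. -/
theorem tendsto_async_recursion (hγ : γ ∈ Set.Ico (0 : ℝ) 1)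
    (hα : ∀ t x, α t x ∈ Set.Icc (0 : ℝ) 1)
    (hsum : ∀ x, Tendsto (fun n => ∑ t ∈ Finset.range n, α t x) atTop atTop)
    (hD : ∀ t x, D (t + 1) x = (1 - α t x) * D t x + α t x * h t x + runningMax D t * ξ t x)
    (hh : ∀ t x, |h t x| ≤ γ * ‖D t‖ + e t) (he : Tendsto e atTop (𝓝 0))
    (hξ : ∀ x, ∃ l, Tendsto (fun n => ∑ t ∈ Finset.range n, ξ t x) atTop (𝓝 l)) :
    Tendsto D atTop (𝓝 0) := by
  obtain ⟨K, hK⟩ := exists_runningMax_le hγ hα hD hh he hξ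
  obtain ⟨hγ0, hγ1⟩ := hγ
  have hK1 : 1 ≤ K := (one_le_runningMax D 0).trans (hK 0)
  have hDK : ∀ t, ‖D t‖ ≤ K := fun t => (norm_le_runningMax D t).trans (hK t)
  have hbdd : IsBoundedUnder (· ≤ ·) atTop fun t => ‖D t‖ := isBoundedUnder_of ⟨K, hDK⟩
  have hbdd' : IsBoundedUnder (· ≥ ·) atTop fun t => ‖D t‖ :=
    isBoundedUnder_of ⟨0, fun t => norm_nonneg _⟩
  set L := limsup (fun t => ‖D t‖) atTop with hL
  have hL0 : 0 ≤ L := le_limsup_of_frequently_le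
    (Frequently.of_forall fun t => norm_nonneg _) hbdd
  -- The three `δ` pay for the error `e`, the forgotten initial value and the noise; the last uses
  -- `G ≤ K` and `η = δ / (2 * K)`.
  have step : ∀ δ > 0, L ≤ γ * (L + δ) + 3 * δ := by
    intro δ hδ
    have h1 : ∀ᶠ t in atTop, ‖D t‖ < L + δ := eventually_lt_of_limsup_lt (by linarith) hbdd
    have h2 : ∀ᶠ t in atTop, e t < δ := he.eventually_lt_const hδ
    have hη : 0 < δ / (2 * K) := by positivity
    obtain ⟨T₁, hT₁⟩ := eventually_atTop.1 (h1.and h2)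
    obtain ⟨T, hT, hTT⟩ := ((exists_noise_small hξ hη).and (eventually_ge_atTop T₁)).exists
    have h3 : ∀ᶠ n in atTop, ∀ x,
        (∏ t ∈ Finset.range (n + 1), (1 - α (T + t) x)) * |D T x| < δ := by
      refine eventually_all.2 fun x => ?_
      have := ((tendsto_prod_one_sub_zero (fun t => hα (T + t) x)
        (tendsto_sum_range_add_atTop T (hsum x))).comp (tendsto_add_atTop_nat 1)).mul_const |D T x|
      rw [zero_mul] at this
      exact this.eventually_lt_const hδ
    have h4 : ∀ᶠ n in atTop, ‖D (n + (T + 1))‖ ≤ γ * (L + δ) + 3 * δ := by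
      filter_upwards [h3] with n hn
      refine (pi_norm_le_iff_of_nonneg (by positivity)).2 fun x => ?_
      have := abs_async_recursion_le (n := n) (H := γ * (L + δ) + δ) hα hD hT x
        (fun t h1 _ => (hh t x).trans (add_le_add (mul_le_mul_of_nonneg_left
          (hT₁ t (hTT.trans h1)).1.le hγ0) (hT₁ t (hTT.trans h1)).2.le))
      rw [show T + n + 1 = n + (T + 1) by ring] at this
      have h5 : 2 * (δ / (2 * K)) * runningMax D (T + n) ≤ δ := by
        calc _ ≤ 2 * (δ / (2 * K)) * K := by gcongr; exact hK _
          _ = δ := by field_simp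
      rw [Real.norm_eq_abs]
      linarith [hn x]
    have h5 := (eventually_map (m := fun n => n + (T + 1)) (f := atTop)
      (P := fun t => ‖D t‖ ≤ γ * (L + δ) + 3 * δ)).2 h4
    rw [map_add_atTop_eq_nat] at h5
    exact limsup_le_of_le hbdd'.isCoboundedUnder_le h5
  have hLz : L ≤ 0 := by
    by_contra! hpos
    have hp : 0 < (1 - γ) * L := mul_pos (by linarith) hpos
    -- Since `γ + 3 < 4`, this `δ` would give `(1 - γ) * L ≤ (1 - γ) * L / 2`.
    have := step ((1 - γ) * L / 8) (by linarith)
    nlinarith [mul_pos hp (sub_pos.2 hγ1)]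
  exact tendsto_zero_iff_norm_tendsto_zero.2 (tendsto_of_le_liminf_of_limsup_le
    (le_liminf_of_le hbdd.isCoboundedUnder_ge (Eventually.of_forall fun t => norm_nonneg _))
    hLz hbdd hbdd')

end vector

/-! ### Almost sure convergence of weighted sums of martingale differences -/

section martingale

variable {Ω : Type*} {mΩ : MeasurableSpace Ω} {μ : Measure Ω} {ℱ : Filtration ℕ mΩ}
  {β Z : ℕ → Ω → ℝ} {v K : ℝ}

theorem memLp_two_mul_of_bound {m : MeasurableSpace Ω} {b z : Ω → ℝ} (hm : m ≤ mΩ)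
    (hb : Measurable[m] b) (hbK : ∀ ω, |b ω| ≤ K) (hz : MemLp z 2 μ) :
    MemLp (fun ω => b ω * z ω) 2 μ := by
  refine hz.of_le_mul (c := K)
    ((hb.mono hm le_rfl).aestronglyMeasurable.mul hz.aestronglyMeasurable) (ae_of_all _ fun ω => ?_)
  rw [norm_mul, Real.norm_eq_abs]
  exact mul_le_mul_of_nonneg_right (hbK ω) (norm_nonneg _)

variable [IsProbabilityMeasure μ]

/-- The partial sums form a martingale with orthogonal increments, so their second moments are at
most `v * K`. They are bounded in L¹, and Doob's convergence theorem applies. -/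
theorem ae_exists_tendsto_of_bounded_weights
    (hβ : ∀ t, Measurable[ℱ t] (β t)) (hβK : ∀ n ω, ∑ t ∈ Finset.range n, β t ω ^ 2 ≤ K)
    (hZ : ∀ t, Measurable[ℱ (t + 1)] (Z t)) (hZ2 : ∀ t, MemLp (Z t) 2 μ)
    (hZ0 : ∀ t, μ[Z t | ℱ t] =ᵐ[μ] 0) (hv0 : 0 ≤ v)
    (hv : ∀ t, ∀ᵐ ω ∂μ, (μ[fun ω => Z t ω ^ 2 | ℱ t]) ω ≤ v) :
    ∀ᵐ ω ∂μ, ∃ l, Tendsto (fun n => ∑ t ∈ Finset.range n, β t ω * Z t ω) atTop (𝓝 l) := by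
  set Mg : ℕ → Ω → ℝ := fun n ω => ∑ t ∈ Finset.range n, β t ω * Z t ω with hMg
  have hsucc : ∀ n ω, Mg (n + 1) ω = Mg n ω + β n ω * Z n ω := fun n ω =>
    Finset.sum_range_succ _ _
  have hβ2 : ∀ t ω, β t ω ^ 2 ≤ K := fun t ω =>
    (Finset.single_le_sum (f := fun t => β t ω ^ 2) (fun _ _ => sq_nonneg _)
      (Finset.self_mem_range_succ t)).trans (hβK (t + 1) ω)
  have hβb : ∀ t ω, |β t ω| ≤ √K := fun t ω => Real.abs_le_sqrt (hβ2 t ω)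
  have hβ' : ∀ t, Measurable (β t) := fun t => (hβ t).mono (ℱ.le t) le_rfl
  have hadp : ∀ n, Measurable[ℱ n] (Mg n) := fun n => by
    refine Finset.measurable_fun_sum _ fun t ht => ?_
    have ht' := Finset.mem_range.1 ht
    exact ((hβ t).mono (ℱ.mono ht'.le) le_rfl).mul ((hZ t).mono (ℱ.mono ht') le_rfl)
  have hd2 : ∀ t, MemLp (fun ω => β t ω * Z t ω) 2 μ := fun t =>
    memLp_two_mul_of_bound (ℱ.le t) (hβ t) (hβb t) (hZ2 t)
  have hM2 : ∀ n, MemLp (Mg n) 2 μ := fun n => memLp_finsetSum _ fun t _ => hd2 t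
  have hMint : ∀ n, Integrable (Mg n) μ := fun n => (hM2 n).integrable one_le_two
  have hZint : ∀ n, Integrable (Z n) μ := fun n => (hZ2 n).integrable one_le_two
  -- Used with `b = β n` for the martingale property, and with `b = β n * Mg n` for the vanishing
  -- cross term in the second moment.
  have hpull : ∀ n (b : Ω → ℝ), Measurable[ℱ n] b → Integrable (b * Z n) μ →
      μ[b * Z n | ℱ n] =ᵐ[μ] 0 := by
    intro n b hb hbi
    refine (condExp_mul_of_stronglyMeasurable_left hb.stronglyMeasurable hbi (hZint n)).trans ?_
    filter_upwards [hZ0 n] with ω hω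
    simp [hω]
  have hmart : Martingale Mg ℱ μ := by
    refine martingale_of_condExp_sub_eq_zero_nat (fun n => (hadp n).stronglyMeasurable) hMint
      fun n => ?_
    have : Mg (n + 1) - Mg n = β n * Z n := by ext ω; simp [hsucc]
    rw [this]
    exact hpull n _ (hβ n) ((hd2 n).integrable one_le_two)
  have hβint : ∀ t, Integrable (fun ω => β t ω ^ 2) μ := fun t =>
    Integrable.of_bound ((hβ' t).pow_const 2).aestronglyMeasurable K
      (ae_of_all _ fun ω => by rw [Real.norm_of_nonneg (sq_nonneg _)]; exact hβ2 t ω)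
  have hsq : ∀ t, ∫ ω, (β t ω * Z t ω) ^ 2 ∂μ ≤ v * ∫ ω, β t ω ^ 2 ∂μ := by
    intro t
    have hmi : Integrable ((fun ω => β t ω ^ 2) * fun ω => Z t ω ^ 2) μ := by
      refine (hd2 t).integrable_sq.congr (ae_of_all _ fun ω => ?_)
      simp [mul_pow]
    have hc := condExp_mul_of_stronglyMeasurable_left
      ((hβ t).pow_const 2).stronglyMeasurable hmi (hZ2 t).integrable_sq
    calc ∫ ω, (β t ω * Z t ω) ^ 2 ∂μ
        = ∫ ω, ((fun ω => β t ω ^ 2) * fun ω => Z t ω ^ 2) ω ∂μ := by simp [mul_pow]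
      _ = ∫ ω, (μ[(fun ω => β t ω ^ 2) * fun ω => Z t ω ^ 2 | ℱ t]) ω ∂μ :=
        (integral_condExp (ℱ.le t)).symm
      _ ≤ ∫ ω, v * β t ω ^ 2 ∂μ := by
        refine integral_mono_ae integrable_condExp ((hβint t).const_mul v) ?_
        filter_upwards [hc, hv t] with ω h1 h2
        rw [h1, Pi.mul_apply, mul_comm]
        exact mul_le_mul_of_nonneg_right h2 (sq_nonneg _)
      _ = v * ∫ ω, β t ω ^ 2 ∂μ := integral_const_mul _ _
  have hMsq : ∀ n, ∫ ω, Mg n ω ^ 2 ∂μ ≤ v * ∫ ω, ∑ t ∈ Finset.range n, β t ω ^ 2 ∂μ := by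
    intro n
    induction n with
    | zero => simp [hMg]
    | succ n ih =>
      have hMb : MemLp (fun ω => β n ω * Mg n ω) 2 μ :=
        memLp_two_mul_of_bound (ℱ.le n) (hβ n) (hβb n) (hM2 n)
      have hci : Integrable ((fun ω => β n ω * Mg n ω) * Z n) μ := hMb.integrable_mul (hZ2 n)
      have hcross : ∫ ω, ((fun ω => β n ω * Mg n ω) * Z n) ω ∂μ = 0 := by
        rw [← integral_condExp (ℱ.le n)]
        exact (integral_congr_ae (hpull n _ ((hβ n).mul (hadp n)) hci)).trans (by simp)
      calc ∫ ω, Mg (n + 1) ω ^ 2 ∂μ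
          = ∫ ω, (Mg n ω ^ 2 + 2 * ((fun ω => β n ω * Mg n ω) * Z n) ω)
              + (β n ω * Z n ω) ^ 2 ∂μ := by
            refine integral_congr_ae (ae_of_all _ fun ω => ?_)
            simp only [hsucc, Pi.mul_apply]
            ring
        _ = ∫ ω, Mg n ω ^ 2 ∂μ + ∫ ω, (β n ω * Z n ω) ^ 2 ∂μ := by
            have hi : Integrable (fun ω =>
                Mg n ω ^ 2 + 2 * ((fun ω => β n ω * Mg n ω) * Z n) ω) μ :=
              (hM2 n).integrable_sq.add (hci.const_mul 2)
            rw [integral_add hi (hd2 n).integrable_sq,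
              integral_add (hM2 n).integrable_sq (hci.const_mul 2), integral_const_mul, hcross]
            ring
        _ ≤ v * ∫ ω, ∑ t ∈ Finset.range (n + 1), β t ω ^ 2 ∂μ := by
            simp only [Finset.sum_range_succ]
            rw [integral_add (integrable_finsetSum _ fun t _ => hβint t) (hβint n), mul_add]
            exact add_le_add ih (hsq n)
  have hbdd : ∀ n, eLpNorm (Mg n) 1 μ ≤ ((1 + v * K).toNNReal : ENNReal) := by
    intro n
    rw [eLpNorm_one_eq_lintegral_enorm, ← ofReal_integral_norm_eq_lintegral_enorm (hMint n)]
    refine ENNReal.ofReal_le_ofReal ?_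
    calc ∫ ω, ‖Mg n ω‖ ∂μ ≤ ∫ ω, (1 + Mg n ω ^ 2) ∂μ := by
          refine integral_mono (hMint n).norm
            ((integrable_const 1).add (hM2 n).integrable_sq) fun ω => ?_
          simp only [Real.norm_eq_abs]
          nlinarith [sq_abs (Mg n ω), sq_nonneg (|Mg n ω| - 1)]
      _ = 1 + ∫ ω, Mg n ω ^ 2 ∂μ := by
          rw [integral_add (integrable_const 1) (hM2 n).integrable_sq]; simp
      _ ≤ 1 + v * ∫ ω, ∑ t ∈ Finset.range n, β t ω ^ 2 ∂μ := by gcongr; exact hMsq n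
      _ ≤ 1 + v * ∫ _, K ∂μ := by
          gcongr
          · exact integrable_finsetSum _ fun t _ => hβint t
          · exact integrable_const K
          · exact fun ω => hβK n ω
      _ = 1 + v * K := by simp
  exact hmart.submartingale.exists_ae_tendsto_of_bdd hbdd

/-- Localization: each weight is kept only while the sum of squares, current term included, is at
most `K`. This event is known at time `t`, so the bounded case applies for every natural `K`; on
almost every path some `K` exceeds the whole sum and nothing is cut off. -/
theorem ae_exists_tendsto_of_summable_sq_weights
    (hβ : ∀ t, Measurable[ℱ t] (β t)) (hβs : ∀ᵐ ω ∂μ, Summable fun t => β t ω ^ 2)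
    (hZ : ∀ t, Measurable[ℱ (t + 1)] (Z t)) (hZ2 : ∀ t, MemLp (Z t) 2 μ)
    (hZ0 : ∀ t, μ[Z t | ℱ t] =ᵐ[μ] 0) (hv0 : 0 ≤ v)
    (hv : ∀ t, ∀ᵐ ω ∂μ, (μ[fun ω => Z t ω ^ 2 | ℱ t]) ω ≤ v) :
    ∀ᵐ ω ∂μ, ∃ l, Tendsto (fun n => ∑ t ∈ Finset.range n, β t ω * Z t ω) atTop (𝓝 l) := by
  classical
  let E : ℕ → ℕ → Set Ω := fun K t => {ω | ∑ k ∈ Finset.range (t + 1), β k ω ^ 2 ≤ K}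
  have hE : ∀ K t, MeasurableSet[ℱ t] (E K t) := fun K t => by
    suffices h : Measurable[ℱ t] fun ω => ∑ k ∈ Finset.range (t + 1), β k ω ^ 2 from
      h measurableSet_Iic
    refine Finset.measurable_fun_sum _ fun k hk => ?_
    exact ((hβ k).mono (ℱ.mono (Nat.lt_succ_iff.1 (Finset.mem_range.1 hk))) le_rfl).pow_const 2
  have hK : ∀ K n : ℕ, ∀ ω, ∑ t ∈ Finset.range n, (E K t).indicator (β t) ω ^ 2 ≤ K := by
    intro K n ω
    induction n with
    | zero => simp
    | succ n ih =>
      by_cases h : ω ∈ E K n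
      · refine le_trans (Finset.sum_le_sum fun t _ => ?_) h
        by_cases h' : ω ∈ E K t
        · simp [h']
        · simpa [h'] using sq_nonneg _
      · simpa [Finset.sum_range_succ, h] using ih
  have hall := ae_all_iff.2 fun K : ℕ => ae_exists_tendsto_of_bounded_weights
    (fun t => (hβ t).indicator (hE K t)) (hK K) hZ hZ2 hZ0 hv0 hv
  filter_upwards [hall, hβs] with ω hω hs
  obtain ⟨K, hKs⟩ := exists_nat_ge (∑' t, β t ω ^ 2)
  obtain ⟨l, hl⟩ := hω K
  refine ⟨l, hl.congr fun n => Finset.sum_congr rfl fun t _ => ?_⟩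
  have : ω ∈ E K t := (hs.sum_le_tsum _ fun _ _ => sq_nonneg _).trans hKs
  rw [Set.indicator_of_mem this]

end martingale

/-! ### Noise along a trajectory -/

namespace IsTrajectory

variable {S A Ω : Type*} [MeasurableSpace S] [MeasurableSpace A]
  {mΩ : MeasurableSpace Ω} {μ : Measure Ω} {ℱ : Filtration ℕ mΩ}
  {M : MDP S A} {s : ℕ → Ω → S} {a : ℕ → Ω → A} {r : ℕ → Ω → ℝ}

theorem measurable_step (h : IsTrajectory M μ ℱ s a r) (t : ℕ) :
    Measurable[ℱ (t + 1)] fun ω => (s (t + 1) ω, r t ω) :=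
  (h.measurable_state (t + 1)).prodMk (h.measurable_reward t)

variable [IsProbabilityMeasure μ]

/-- On an event of the past on which `(x, y)` is visited, the next pair has law `M.step x y`. -/
theorem map_restrict_eq (h : IsTrajectory M μ ℱ s a r) (t : ℕ) (x : S) (y : A) {F : Set Ω}
    (hF : MeasurableSet[ℱ t] F) (hFE : F ⊆ {ω | s t ω = x ∧ a t ω = y}) :
    (μ.restrict F).map (fun ω => (s (t + 1) ω, r t ω)) = μ F • M.step x y := by
  have := M.isProbabilityMeasure_step
  have hm := (h.measurable_step t).mono (ℱ.le _) le_rfl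
  have hF' := ℱ.le t _ hF
  ext B hB
  rw [Measure.map_apply hm hB, Measure.restrict_apply (hm hB), Measure.smul_apply, smul_eq_mul,
    ← ENNReal.toReal_eq_toReal_iff' (measure_ne_top _ _)
      (ENNReal.mul_ne_top (measure_ne_top _ _) (measure_ne_top _ _)), ENNReal.toReal_mul]
  have hBm : MeasurableSet {ω | (s (t + 1) ω, r t ω) ∈ B} := hm hB
  calc (μ ((fun ω => (s (t + 1) ω, r t ω)) ⁻¹' B ∩ F)).toReal
      = ∫ ω in F, Set.indicator {ω | (s (t + 1) ω, r t ω) ∈ B} (fun _ => (1 : ℝ)) ω ∂μ := by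
        rw [integral_indicator hBm, setIntegral_const, measureReal_restrict_apply hBm]
        simp [Measure.real, Set.preimage]
    _ = ∫ ω in F, (M.step (s t ω) (a t ω)).real B ∂μ := by
        rw [← setIntegral_condExp (ℱ.le t) ((integrable_const _).indicator hBm) hF]
        exact setIntegral_congr_ae hF' ((h.markov t B hB).mono fun ω hω _ => hω)
    _ = ∫ ω in F, (M.step x y).real B ∂μ := by
        refine setIntegral_congr_fun hF' fun ω hω => ?_
        simp only [(hFE hω).1, (hFE hω).2]
    _ = _ := by simp [Measure.real]

variable [DiscreteMeasurableSpace S] [DiscreteMeasurableSpace A]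

omit [IsProbabilityMeasure μ] in
theorem measurableSet_visit (h : IsTrajectory M μ ℱ s a r) (t : ℕ) (x : S) (y : A) :
    MeasurableSet[ℱ t] {ω | s t ω = x ∧ a t ω = y} :=
  (h.measurable_state t (MeasurableSet.of_discrete (s := {x}))).inter
    (h.measurable_action t (MeasurableSet.of_discrete (s := {y})))

variable {φ : S × ℝ → ℝ}

theorem integrable_indicator_visit (h : IsTrajectory M μ ℱ s a r) (t : ℕ) (x : S) (y : A)
    (hφ : Integrable φ (M.step x y)) :
    Integrable ({ω | s t ω = x ∧ a t ω = y}.indicator fun ω => φ (s (t + 1) ω, r t ω)) μ := by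
  have hE := h.measurableSet_visit t x y
  have hm := (h.measurable_step t).mono (ℱ.le _) le_rfl
  rw [integrable_indicator_iff (ℱ.le t _ hE)]
  have : Integrable φ ((μ.restrict {ω | s t ω = x ∧ a t ω = y}).map
      fun ω => (s (t + 1) ω, r t ω)) := by
    rw [h.map_restrict_eq t x y hE subset_rfl]
    exact hφ.smul_measure (measure_ne_top _ _)
  exact this.comp_measurable hm

/-- Extends the Markov property from events to integrable functions: over any past event `F`,
`map_restrict_eq` on the intersection of `F` with the visit gives both sides the same integral. -/
theorem condExp_indicator_visit (h : IsTrajectory M μ ℱ s a r) (t : ℕ) (x : S) (y : A)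
    (hφ : Integrable φ (M.step x y)) :
    μ[{ω | s t ω = x ∧ a t ω = y}.indicator fun ω => φ (s (t + 1) ω, r t ω) | ℱ t]
      =ᵐ[μ] {ω | s t ω = x ∧ a t ω = y}.indicator fun _ => ∫ z, φ z ∂(M.step x y) := by
  have hE := h.measurableSet_visit t x y
  have hE' := ℱ.le t _ hE
  have hm := (h.measurable_step t).mono (ℱ.le _) le_rfl
  refine (ae_eq_condExp_of_forall_setIntegral_eq (ℱ.le t)
    (h.integrable_indicator_visit t x y hφ)
    (fun F _ _ => ((integrable_const _).indicator hE').integrableOn) (fun F hF _ => ?_)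
    (stronglyMeasurable_const.indicator hE).aestronglyMeasurable).symm
  have hmap := h.map_restrict_eq t x y (hF.inter hE) Set.inter_subset_right
  rw [setIntegral_indicator hE', setIntegral_indicator hE', setIntegral_const]
  have hφ' : AEStronglyMeasurable φ ((μ.restrict (F ∩ {ω | s t ω = x ∧ a t ω = y})).map
      fun ω => (s (t + 1) ω, r t ω)) := by
    rw [hmap]
    exact hφ.aestronglyMeasurable.smul_measure _
  rw [← integral_map hm.aemeasurable hφ', hmap, integral_smul_measure, Measure.real]

/-- Weighted sums of centered functions of (next state, reward) over the visits to `(x, y)`. -/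
theorem ae_exists_tendsto_noise (h : IsTrajectory M μ ℱ s a r) (x : S) (y : A)
    (hφm : Measurable φ) (hφ : MemLp φ 2 (M.step x y)) {β : ℕ → Ω → ℝ}
    (hβ : ∀ t, Measurable[ℱ t] (β t)) (hβs : ∀ᵐ ω ∂μ, Summable fun t => β t ω ^ 2)
    (hβ0 : ∀ᵐ ω ∂μ, ∀ t, (x, y) ≠ (s t ω, a t ω) → β t ω = 0) :
    ∀ᵐ ω ∂μ, ∃ l, Tendsto (fun n => ∑ t ∈ Finset.range n,
      β t ω * (φ (s (t + 1) ω, r t ω) - ∫ z, φ z ∂(M.step x y))) atTop (𝓝 l) := by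
  have := M.isProbabilityMeasure_step
  set ψ : S × ℝ → ℝ := fun z => φ z - ∫ z, φ z ∂(M.step x y) with hψ
  have hψm : Measurable ψ := hφm.sub_const _
  have hψ2 : MemLp ψ 2 (M.step x y) := hφ.sub (memLp_const _)
  have hψi : Integrable ψ (M.step x y) := hψ2.integrable one_le_two
  have hψ0 : ∫ z, ψ z ∂(M.step x y) = 0 := by
    rw [hψ, integral_sub (hφ.integrable one_le_two) (integrable_const _)]; simp
  -- The centering is correct only on visits to `(x, y)`. Off them `Z` is set to `0`, which does not
  -- change the weighted sums because the weights vanish there.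
  let Z : ℕ → Ω → ℝ := fun t =>
    {ω | s t ω = x ∧ a t ω = y}.indicator fun ω => ψ (s (t + 1) ω, r t ω)
  have hZ : ∀ t, Measurable[ℱ (t + 1)] (Z t) := fun t =>
    (hψm.comp (h.measurable_step t)).indicator (ℱ.mono t.le_succ _ (h.measurableSet_visit t x y))
  have hZsq : ∀ t, (fun ω => Z t ω ^ 2) =
      {ω | s t ω = x ∧ a t ω = y}.indicator fun ω => ψ (s (t + 1) ω, r t ω) ^ 2 := fun t => by
    ext ω
    by_cases hω : ω ∈ {ω | s t ω = x ∧ a t ω = y}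
    · simp only [Z, Set.indicator_of_mem hω]
    · simp only [Z, Set.indicator_of_notMem hω]; simp
  have key := ae_exists_tendsto_of_summable_sq_weights (μ := μ) (ℱ := ℱ) (β := β) (Z := Z)
    (v := ∫ z, ψ z ^ 2 ∂(M.step x y)) hβ hβs hZ
    (fun t => by
      rw [memLp_two_iff_integrable_sq ((hZ t).mono (ℱ.le _) le_rfl).aestronglyMeasurable, hZsq]
      exact h.integrable_indicator_visit (φ := fun z => ψ z ^ 2) t x y hψ2.integrable_sq)
    (fun t => (h.condExp_indicator_visit t x y hψi).trans (by simp [hψ0]; rfl))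
    (integral_nonneg fun _ => sq_nonneg _)
    (fun t => by
      rw [hZsq]
      filter_upwards [h.condExp_indicator_visit (φ := fun z => ψ z ^ 2) t x y
        hψ2.integrable_sq] with ω hω
      rw [hω]
      exact Set.indicator_le_self' (fun _ _ => integral_nonneg fun _ => sq_nonneg _) ω)
  filter_upwards [key, hβ0] with ω hω h0
  obtain ⟨l, hl⟩ := hω
  refine ⟨l, hl.congr fun n => Finset.sum_congr rfl fun t _ => ?_⟩
  by_cases hv : ω ∈ {ω | s t ω = x ∧ a t ω = y}
  · simp only [Z, Set.indicator_of_mem hv, hψ]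
  · rw [h0 t fun e => hv ⟨(Prod.mk.inj e).1.symm, (Prod.mk.inj e).2.symm⟩]; simp

end IsTrajectory

/-! ### The Bellman optimality operator -/

theorem abs_ciSup_sub_ciSup_le {A : Type*} [Finite A] [Nonempty A] {f g : A → ℝ} {c : ℝ}
    (h : ∀ y, |f y - g y| ≤ c) : |(⨆ y, f y) - ⨆ y, g y| ≤ c := by
  have key : ∀ u w : A → ℝ, (∀ y, |u y - w y| ≤ c) → (⨆ y, u y) ≤ (⨆ y, w y) + c := by
    intro u w huw
    refine ciSup_le fun y => ?_
    have := le_ciSup (Set.finite_range w).bddAbove y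
    linarith [(abs_le.1 (huw y)).2]
  have h₁ := key f g h
  have h₂ := key g f fun y => by rw [abs_sub_comm]; exact h y
  exact abs_le.2 ⟨by linarith, by linarith⟩

namespace MDP

variable {S A : Type*} [MeasurableSpace S] (M : MDP S A)

theorem transProb_nonneg (x : S) (y : A) (x' : S) : 0 ≤ M.transProb x y x' :=
  measureReal_nonneg

variable [Fintype S]

theorem sum_transProb [DiscreteMeasurableSpace S] (x : S) (y : A) :
    ∑ x', M.transProb x y x' = 1 := by
  have := M.isProbabilityMeasure_step x y
  have h := measureReal_biUnion_finset (μ := M.step x y) (s := Finset.univ)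
    (f := fun x' : S => {z : S × ℝ | z.1 = x'})
    (fun i _ j _ hij => Set.disjoint_left.2 fun z hi hj => hij (hi.symm.trans hj))
    (fun x' _ => measurable_fst (MeasurableSet.of_discrete (s := {x'})))
  rw [show (⋃ x' ∈ Finset.univ, {z : S × ℝ | z.1 = x'}) = Set.univ by ext; simp,
    probReal_univ] at h
  exact h.symm

theorem abs_sum_transProb_sub_le [DiscreteMeasurableSpace S] {V W : S → ℝ} {c : ℝ}
    (h : ∀ x', |V x' - W x'| ≤ c) (x : S) (y : A) :
    |∑ x', M.transProb x y x' * V x' - ∑ x', M.transProb x y x' * W x'| ≤ c := by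
  rw [← Finset.sum_sub_distrib]
  calc _ ≤ ∑ x', |M.transProb x y x' * V x' - M.transProb x y x' * W x'| :=
        Finset.abs_sum_le_sum_abs _ _
    _ ≤ ∑ x', M.transProb x y x' * c := by
        refine Finset.sum_le_sum fun x' _ => ?_
        rw [← mul_sub, abs_mul, abs_of_nonneg (M.transProb_nonneg x y x')]
        exact mul_le_mul_of_nonneg_left (h x') (M.transProb_nonneg x y x')
    _ = c := by rw [← Finset.sum_mul, M.sum_transProb, one_mul]

/-- The Bellman optimality operator. -/
noncomputable def bellmanOp (γ : ℝ) (Q : S → A → ℝ) : S → A → ℝ := fun x y =>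
  M.meanReward x y + γ * ∑ x', M.transProb x y x' * ⨆ y', Q x' y'

variable [DiscreteMeasurableSpace S] [Fintype A] [Nonempty A] {γ : ℝ}

theorem contractingWith_bellmanOp (hγ : γ ∈ Set.Ico (0 : ℝ) 1) :
    ContractingWith ⟨γ, hγ.1⟩ (M.bellmanOp γ) := by
  refine ⟨hγ.2, LipschitzWith.of_dist_le_mul fun Q Q' => ?_⟩
  have hγ0 := hγ.1
  refine (dist_pi_le_iff (mul_nonneg hγ0 dist_nonneg)).2 fun x =>
    (dist_pi_le_iff (mul_nonneg hγ0 dist_nonneg)).2 fun y => ?_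
  rw [Real.dist_eq, bellmanOp, bellmanOp, add_sub_add_left_eq_sub, ← mul_sub, abs_mul,
    abs_of_nonneg hγ0]
  refine mul_le_mul_of_nonneg_left (M.abs_sum_transProb_sub_le
    (fun x' => abs_ciSup_sub_ciSup_le fun y' => ?_) x y) hγ0
  exact (dist_le_pi_dist (Q x') (Q' x') y').trans (dist_le_pi_dist Q Q' x')

theorem exists_bellmanOptimality_iff (hγ : γ ∈ Set.Ico (0 : ℝ) 1) :
    ∃ Qstar : S → A → ℝ, ∀ Q, M.BellmanOptimality γ Q ↔ Q = Qstar := by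
  have hc := M.contractingWith_bellmanOp hγ
  have hiff : ∀ Q, M.BellmanOptimality γ Q ↔ Function.IsFixedPt (M.bellmanOp γ) Q := fun Q =>
    ⟨fun h => funext fun x => funext fun y => (h x y).symm,
      fun h x y => (congrFun (congrFun h x) y).symm⟩
  refine ⟨ContractingWith.fixedPoint _ hc, fun Q => (hiff Q).trans
    ⟨fun h => hc.fixedPoint_unique h, ?_⟩⟩
  rintro rfl
  exact hc.fixedPoint_isFixedPt

end MDP

/-! ### Convergence of clipped triple Q-learning -/

theorem Measurable.eval_table {S A Ω : Type*} [Countable S] [MeasurableSpace S]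
    [DiscreteMeasurableSpace S] [Countable A] [MeasurableSpace A] [DiscreteMeasurableSpace A]
    {m : MeasurableSpace Ω} {Q : Ω → S → A → ℝ} {u : Ω → S} {w : Ω → A}
    (hQ : ∀ x y, Measurable fun ω => Q ω x y) (hu : Measurable u) (hw : Measurable w) :
    Measurable fun ω => Q ω (u ω) (w ω) := by
  have : Measurable fun p : Ω × S × A => Q p.1 p.2.1 p.2.2 :=
    measurable_from_prod_countable_left fun y => hQ y.1 y.2
  exact this.comp (measurable_id.prodMk (hu.prodMk hw))

/-- Makes the inverse of the running maximum admissible in the martingale weights. -/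
theorem measurable_runningMax {Ω ι : Type*} [Fintype ι] {mΩ : MeasurableSpace Ω}
    {ℱ : Filtration ℕ mΩ} {D : ℕ → Ω → ι → ℝ} (hD : ∀ t x, Measurable[ℱ t] fun ω => D t ω x)
    (t : ℕ) : Measurable[ℱ t] fun ω => runningMax (fun k => D k ω) t := by
  have hn : ∀ t, Measurable[ℱ t] fun ω => ‖D t ω‖ := fun t =>
    measurable_norm.comp (@measurable_pi_lambda _ _ _ (ℱ t) _ _ (hD t))
  induction t with
  | zero => exact measurable_const.max (hn 0)
  | succ t ih => exact (ih.mono (ℱ.mono t.le_succ) le_rfl).max (hn (t + 1))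

section

variable {S A Ω : Type*} [Fintype S] [MeasurableSpace S] [DiscreteMeasurableSpace S]
  [Fintype A] [Nonempty A] [MeasurableSpace A] [DiscreteMeasurableSpace A]
  {mΩ : MeasurableSpace Ω} {μ : Measure Ω} [IsProbabilityMeasure μ] {ℱ : Filtration ℕ mΩ}
  {M : MDP S A} {γ : ℝ} {s : ℕ → Ω → S} {a : ℕ → Ω → A} {r : ℕ → Ω → ℝ}
  {α : ℕ → Ω → S → A → ℝ} {g : ℝ → ℝ → ℝ → ℝ} {aStar : ℕ → Ω → A}
  {QA QB QC : ℕ → Ω → S → A → ℝ}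

omit [IsProbabilityMeasure μ] [Nonempty A] in
theorem IsClippedTripleQ.measurable (hQ : IsClippedTripleQ ℱ γ g s r aStar α QA QB QC)
    (htraj : IsTrajectory M μ ℱ s a r) (hα : IsLearningRate μ ℱ s a α) (hg : IsTargetMap g)
    (t : ℕ) : (∀ x y, Measurable[ℱ t] fun ω => QA t ω x y) ∧
      (∀ x y, Measurable[ℱ t] fun ω => QB t ω x y) ∧
      ∀ x y, Measurable[ℱ t] fun ω => QC t ω x y := by
  induction t with
  | zero => exact ⟨hQ.measurable_initA, hQ.measurable_initB, hQ.measurable_initC⟩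
  | succ t ih =>
    have up : ∀ {Q : Ω → ℝ}, Measurable[ℱ t] Q → Measurable[ℱ (t + 1)] Q := fun h =>
      h.mono (ℱ.mono t.le_succ) le_rfl
    have hs := htraj.measurable_state (t + 1)
    have ha := hQ.measurable_argmax t
    have ev : ∀ {Q : Ω → S → A → ℝ}, (∀ x y, Measurable[ℱ t] fun ω => Q ω x y) →
        Measurable[ℱ (t + 1)] fun ω => Q ω (s (t + 1) ω) (aStar t ω) := fun h =>
      Measurable.eval_table (fun x y => up (h x y)) hs ha
    have hy : Measurable[ℱ (t + 1)] fun ω => sharedTarget γ g (QA t ω) (QB t ω) (QC t ω) (r t ω)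
        (s (t + 1) ω) (aStar t ω) :=
      (htraj.measurable_reward t).add ((hg.measurable.comp
        ((ev ih.1).prodMk ((ev ih.2.1).prodMk (ev ih.2.2)))).const_mul γ)
    refine ⟨fun x y => ?_, fun x y => ?_, fun x y => ?_⟩
    · simp only [hQ.updateA]
      exact (up (ih.1 x y)).add ((up (hα.measurable t x y)).mul (hy.sub (up (ih.1 x y))))
    · simp only [hQ.updateB]
      exact (up (ih.2.1 x y)).add ((up (hα.measurable t x y)).mul (hy.sub (up (ih.2.1 x y))))
    · simp only [hQ.updateC]
      exact (up (ih.2.2 x y)).add ((up (hα.measurable t x y)).mul (hy.sub (up (ih.2.2 x y))))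

omit [DiscreteMeasurableSpace S] [Fintype A] [Nonempty A] [MeasurableSpace A]
  [DiscreteMeasurableSpace A] [Fintype S] [MeasurableSpace S] [IsProbabilityMeasure μ] in
/-- Tables moved toward a common target with divergent step sizes merge. -/
theorem IsLearningRate.tendsto_sub_zero (hα : IsLearningRate μ ℱ s a α)
    {P Q : ℕ → Ω → S → A → ℝ} {y : ℕ → Ω → ℝ}
    (hP : ∀ t ω x z, P (t + 1) ω x z = P t ω x z + α t ω x z * (y t ω - P t ω x z))
    (hQ : ∀ t ω x z, Q (t + 1) ω x z = Q t ω x z + α t ω x z * (y t ω - Q t ω x z)) :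
    ∀ᵐ ω ∂μ, ∀ x z, Tendsto (fun t => P t ω x z - Q t ω x z) atTop (𝓝 0) := by
  filter_upwards [hα.mem_Icc, hα.sum_eq_top] with ω h1 h2 x z
  refine tendsto_zero_of_contracting_recursion (fun t => h1 t x z) (h2 x z) fun t => ?_
  rw [hP, hQ]
  ring

omit [Nonempty A] [Fintype S] [Fintype A] in
/-- The noise of one entry, with weights bounded by a multiple of the learning rates. -/
theorem IsTrajectory.ae_exists_tendsto_learning_noise (htraj : IsTrajectory M μ ℱ s a r)
    (hα : IsLearningRate μ ℱ s a α) (x : S) (y : A) {φ : S × ℝ → ℝ} (hφm : Measurable φ)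
    (hφ : MemLp φ 2 (M.step x y)) {c : ℕ → Ω → ℝ} {C : ℝ} (hc : ∀ t, Measurable[ℱ t] (c t))
    (hcC : ∀ t ω, |c t ω| ≤ C) :
    ∀ᵐ ω ∂μ, ∃ l, Tendsto (fun n => ∑ t ∈ Finset.range n,
      α t ω x y * c t ω * (φ (s (t + 1) ω, r t ω) - ∫ z, φ z ∂(M.step x y))) atTop (𝓝 l) := by
  refine htraj.ae_exists_tendsto_noise x y hφm hφ (β := fun t ω => α t ω x y * c t ω)
    (fun t => (hα.measurable t x y).mul (hc t)) ?_ ?_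
  · filter_upwards [hα.summable_sq] with ω h
    refine Summable.of_nonneg_of_le (fun _ => sq_nonneg _) (fun t => ?_) ((h x y).mul_right (C ^ 2))
    rw [mul_pow]
    exact mul_le_mul_of_nonneg_left (sq_le_sq' (abs_le.1 (hcC t ω)).1 (abs_le.1 (hcC t ω)).2)
      (sq_nonneg _)
  · filter_upwards [hα.eq_zero] with ω h t ht
    rw [h t x y ht, zero_mul]

omit [Fintype S] [Fintype A] [Nonempty A] [MeasurableSpace A] [DiscreteMeasurableSpace A] in
theorem MDP.integral_indicator_state (x : S) (y : A) (x' : S) :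
    ∫ z, {z : S × ℝ | z.1 = x'}.indicator (fun _ => (1 : ℝ)) z ∂(M.step x y)
      = M.transProb x y x' := by
  have hm : MeasurableSet {z : S × ℝ | z.1 = x'} :=
    measurable_fst (MeasurableSet.of_discrete (s := {x'}))
  rw [integral_indicator hm, setIntegral_const, smul_eq_mul, mul_one, MDP.transProb]

theorem IsClippedTripleQ.ae_tendsto (hQ : IsClippedTripleQ ℱ γ g s r aStar α QA QB QC)
    (hγ : γ ∈ Set.Ico (0 : ℝ) 1) (hvar : M.FiniteRewardVariance)
    (htraj : IsTrajectory M μ ℱ s a r) (hα : IsLearningRate μ ℱ s a α) (hg : IsTargetMap g)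
    {Qstar : S → A → ℝ} (hstar : M.BellmanOptimality γ Qstar) :
    ∀ᵐ ω ∂μ, ∀ x y, Tendsto (fun t => QA t ω x y) atTop (𝓝 (Qstar x y)) := by
  classical
  have := M.isProbabilityMeasure_step
  have hmeas := fun t => (hQ.measurable htraj hα hg t).1
  let D : ℕ → Ω → S × A → ℝ := fun t ω p => QA t ω p.1 p.2 - Qstar p.1 p.2
  let G : ℕ → Ω → ℝ := fun t ω => runningMax (fun k => D k ω) t
  let V : ℕ → Ω → S → ℝ := fun t ω x => ⨆ y, QA t ω x y
  -- The bias relative to ordinary Q-learning. It is handled path by path, outside the martingale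
  -- noise.
  let e : ℕ → Ω → ℝ := fun t ω => g (QA t ω (s (t + 1) ω) (aStar t ω))
    (QB t ω (s (t + 1) ω) (aStar t ω)) (QC t ω (s (t + 1) ω) (aStar t ω)) - V t ω (s (t + 1) ω)
  let φ : S → S × ℝ → ℝ := fun x' => {z : S × ℝ | z.1 = x'}.indicator fun _ => 1
  have hG1 : ∀ t ω, 1 ≤ G t ω := fun t ω => one_le_runningMax _ t
  have hGm : ∀ t, Measurable[ℱ t] (G t) :=
    measurable_runningMax fun t p => (hmeas t p.1 p.2).sub_const _
  have hDG : ∀ t ω x y, |QA t ω x y - Qstar x y| ≤ ‖D t ω‖ := fun t ω x y =>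
    norm_le_pi_norm (D t ω) (x, y)
  have hVD : ∀ t ω x, |V t ω x - ⨆ y, Qstar x y| ≤ ‖D t ω‖ := fun t ω x =>
    abs_ciSup_sub_ciSup_le (hDG t ω x)
  have hVm : ∀ t x, Measurable[ℱ t] fun ω => V t ω x := fun t x =>
    Measurable.iSup fun y => hmeas t x y
  have hφm : ∀ x', Measurable (φ x') := fun x' => measurable_const.indicator
    (measurable_fst (MeasurableSet.of_discrete (s := {x'})))
  have hreward : ∀ᵐ ω ∂μ, ∀ x y, ∃ l, Tendsto (fun n => ∑ t ∈ Finset.range n,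
      α t ω x y * (G t ω)⁻¹ * (r t ω - M.meanReward x y)) atTop (𝓝 l) := by
    refine ae_all_iff.2 fun x => ae_all_iff.2 fun y => ?_
    refine htraj.ae_exists_tendsto_learning_noise hα x y (φ := Prod.snd) (C := 1) measurable_snd
      ((evariance_lt_top_iff_memLp measurable_snd.aestronglyMeasurable).1 (hvar x y))
      (fun t => (hGm t).inv) fun t ω => ?_
    rw [abs_inv, abs_of_nonneg (zero_le_one.trans (hG1 t ω))]
    exact inv_le_one_of_one_le₀ (hG1 t ω)
  -- `V t` is random, while the noise lemma takes a fixed `φ`. Expanding `V t` at the next state in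
  -- indicators of single states moves its values into the weights, where they need only be known at
  -- time `t`.
  have hstate : ∀ᵐ ω ∂μ, ∀ x y x', ∃ l, Tendsto (fun n => ∑ t ∈ Finset.range n,
      α t ω x y * (V t ω x' * (G t ω)⁻¹) * (φ x' (s (t + 1) ω, r t ω) - M.transProb x y x'))
      atTop (𝓝 l) := by
    refine ae_all_iff.2 fun x => ae_all_iff.2 fun y => ae_all_iff.2 fun x' => ?_
    rw [← MDP.integral_indicator_state]
    refine htraj.ae_exists_tendsto_learning_noise hα x y (φ := φ x')
      -- From `|V| ≤ ‖D‖ + |⨆ y, Qstar x' y|`, with `‖D‖ ≤ G` and `1 ≤ G`.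
      (C := 1 + |⨆ y, Qstar x' y|) (c := fun t ω => V t ω x' * (G t ω)⁻¹) (hφm x')
      ((memLp_const 1).indicator (measurable_fst (MeasurableSet.of_discrete (s := {x'}))))
      (fun t => (hVm t x').mul (hGm t).inv) fun t ω => ?_
    have hG := hG1 t ω
    rw [← div_eq_mul_inv, abs_div, abs_of_nonneg (zero_le_one.trans hG),
      div_le_iff₀ (zero_lt_one.trans_le hG)]
    have h1 := abs_sub_abs_le_abs_sub (V t ω x') (⨆ y, Qstar x' y)
    have h2 : ‖D t ω‖ ≤ G t ω := norm_le_runningMax (fun k => D k ω) t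
    have h3 := le_mul_of_one_le_right (abs_nonneg (⨆ y, Qstar x' y)) hG
    linarith [hVD t ω x']
  filter_upwards [hα.mem_Icc, hα.sum_eq_top, hreward, hstate,
    hα.tendsto_sub_zero hQ.updateB hQ.updateA, hα.tendsto_sub_zero hQ.updateC hQ.updateA]
    with ω hIcc hsum hre hst hBA hCA
  -- By maximality of `aStar`, `e` has the form `g x y z - x`, which the near-diagonal property
  -- controls.
  have hVmax : ∀ t, V t ω (s (t + 1) ω) = QA t ω (s (t + 1) ω) (aStar t ω) := fun t =>
    le_antisymm (ciSup_le fun y => hQ.argmax t ω y) (le_ciSup (Set.finite_range _).bddAbove _)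
  have he : Tendsto (fun t => γ * |e t ω|) atTop (𝓝 0) := by
    have : Tendsto (fun t => e t ω) atTop (𝓝 0) := by
      refine Metric.tendsto_nhds.2 fun ε hε => ?_
      obtain ⟨δ, hδ, hgδ⟩ := hg.near_diagonal (ε / 2) (by linarith)
      have h1 : ∀ᶠ t in atTop, ∀ x y, |QB t ω x y - QA t ω x y| ≤ δ :=
        eventually_all.2 fun x => eventually_all.2 fun y =>
          ((hBA x y).eventually (Metric.closedBall_mem_nhds 0 hδ)).mono fun t ht => by
            simpa using ht
      have h2 : ∀ᶠ t in atTop, ∀ x y, |QC t ω x y - QA t ω x y| ≤ δ :=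
        eventually_all.2 fun x => eventually_all.2 fun y =>
          ((hCA x y).eventually (Metric.closedBall_mem_nhds 0 hδ)).mono fun t ht => by
            simpa using ht
      filter_upwards [h1, h2] with t h1 h2
      rw [Real.dist_eq, sub_zero]
      simp only [e, hVmax]
      exact (hgδ _ _ _ (h1 _ _) (h2 _ _)).trans_lt (by linarith)
    simpa using this.abs.const_mul γ
  -- `h` is the contracting Bellman difference plus the bias; `ξ` is the centered reward and
  -- next-state noise, multiplied by the step size and divided by `G`.
  let h : ℕ → S × A → ℝ := fun t p => γ * (∑ x', M.transProb p.1 p.2 x' * V t ω x'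
    - ∑ x', M.transProb p.1 p.2 x' * ⨆ y, Qstar x' y) + γ * e t ω
  let ξ : ℕ → S × A → ℝ := fun t p =>
    α t ω p.1 p.2 * (G t ω)⁻¹ * (r t ω - M.meanReward p.1 p.2)
      + γ * ∑ x', α t ω p.1 p.2 * (V t ω x' * (G t ω)⁻¹) *
        (φ x' (s (t + 1) ω, r t ω) - M.transProb p.1 p.2 x')
  have hmain : Tendsto (fun t => D t ω) atTop (𝓝 0) := by
    refine tendsto_async_recursion hγ (α := fun t p => α t ω p.1 p.2) (h := h) (ξ := ξ)
      (fun t p => hIcc t p.1 p.2) (fun p => hsum p.1 p.2) (fun t p => ?_) (fun t p => ?_) he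
      (fun p => ?_)
    · have hG0 : G t ω ≠ 0 := (zero_lt_one.trans_le (hG1 t ω)).ne'
      have hsumφ : ∑ x', V t ω x' * φ x' (s (t + 1) ω, r t ω) = V t ω (s (t + 1) ω) := by
        simp [φ, Set.indicator_apply]
      have hnoise : ∑ x', α t ω p.1 p.2 * (V t ω x' * (G t ω)⁻¹) *
          (φ x' (s (t + 1) ω, r t ω) - M.transProb p.1 p.2 x') = α t ω p.1 p.2 * (G t ω)⁻¹ *
          (V t ω (s (t + 1) ω) - ∑ x', M.transProb p.1 p.2 x' * V t ω x') := by
        rw [← hsumφ, ← Finset.sum_sub_distrib, Finset.mul_sum]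
        exact Finset.sum_congr rfl fun x' _ => by ring
      have hstar' := hstar p.1 p.2
      change QA (t + 1) ω p.1 p.2 - Qstar p.1 p.2 =
        (1 - α t ω p.1 p.2) * (QA t ω p.1 p.2 - Qstar p.1 p.2)
        + α t ω p.1 p.2 * h t p + G t ω * ξ t p
      simp only [h, ξ, hnoise, e, hQ.updateA, sharedTarget]
      have hcancel : ∀ u w : ℝ, G t ω * (u * (G t ω)⁻¹ * w) = u * w := fun u w => by
        field_simp
      rw [mul_add (G t ω), mul_left_comm (G t ω) γ, hcancel, hcancel]
      -- The Bellman equation for `Qstar` cancels the mean reward and the discounted optimal value.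
      linear_combination (-α t ω p.1 p.2) * hstar'
    · refine (abs_add_le _ _).trans (add_le_add ?_ ?_)
      · rw [abs_mul, abs_of_nonneg hγ.1]
        exact mul_le_mul_of_nonneg_left (M.abs_sum_transProb_sub_le (hVD t ω) _ _) hγ.1
      · rw [abs_mul, abs_of_nonneg hγ.1]
    · obtain ⟨l, hl⟩ := hre p.1 p.2
      choose k hk using hst p.1 p.2
      refine ⟨l + γ * ∑ x', k x', (hl.add ((tendsto_finsetSum _ fun x' _ => hk x').const_mul
        γ)).congr fun n => ?_⟩
      simp only [ξ]
      rw [Finset.sum_add_distrib, ← Finset.mul_sum, Finset.sum_comm]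
  intro x y
  have := (tendsto_pi_nhds.1 hmain (x, y)).add_const (Qstar x y)
  simpa [D] using this

end

theorem mainTheorem1 {S A Ω : Type*}
    [Fintype S] [Nonempty S] [MeasurableSpace S] [DiscreteMeasurableSpace S]
    [Fintype A] [Nonempty A] [MeasurableSpace A] [DiscreteMeasurableSpace A]
    {mΩ : MeasurableSpace Ω} (μ : Measure Ω) [IsProbabilityMeasure μ] (ℱ : Filtration ℕ mΩ)
    (M : MDP S A) (γ : ℝ) (hγ : γ ∈ Set.Ico (0 : ℝ) 1) (hvar : M.FiniteRewardVariance)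
    (s : ℕ → Ω → S) (a : ℕ → Ω → A) (r : ℕ → Ω → ℝ) (htraj : IsTrajectory M μ ℱ s a r)
    (hvisit : ∀ᵐ ω ∂μ, ∀ x y, ∃ᶠ t in atTop, s t ω = x ∧ a t ω = y)
    (α : ℕ → Ω → S → A → ℝ) (hα : IsLearningRate μ ℱ s a α) :
    -- the two strategies used in practice are target maps
    IsTargetMap meanSmallerTwo ∧ IsTargetMap medianThree ∧
    -- the Bellman optimality equation has exactly one solution, and the tables converge to it
    ∃ Qstar : S → A → ℝ, (∀ Q, M.BellmanOptimality γ Q ↔ Q = Qstar) ∧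
      ∀ g : ℝ → ℝ → ℝ → ℝ, IsTargetMap g →
        ∀ (aStar : ℕ → Ω → A) (QA QB QC : ℕ → Ω → S → A → ℝ),
          IsClippedTripleQ ℱ γ g s r aStar α QA QB QC →
          ∀ᵐ ω ∂μ, ∀ x y,
            Tendsto (fun t => QA t ω x y) atTop (𝓝 (Qstar x y)) ∧
            Tendsto (fun t => QB t ω x y) atTop (𝓝 (Qstar x y)) ∧
            Tendsto (fun t => QC t ω x y) atTop (𝓝 (Qstar x y)) := by
  obtain ⟨Qstar, hstar⟩ := M.exists_bellmanOptimality_iff hγ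
  refine ⟨isTargetMap_meanSmallerTwo, isTargetMap_medianThree, Qstar, hstar,
    fun g hg aStar QA QB QC hQ => ?_⟩
  filter_upwards [hQ.ae_tendsto hγ hvar htraj hα hg ((hstar Qstar).2 rfl),
    hα.tendsto_sub_zero hQ.updateB hQ.updateA, hα.tendsto_sub_zero hQ.updateC hQ.updateA]
    with ω hA hBA hCA x y
  refine ⟨hA x y, ?_, ?_⟩
  · simpa using (hBA x y).add (hA x y)
  · simpa using (hCA x y).add (hA x y)
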